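/- Let $\mathbb{D}=\{z\in\mathbb{C}:|z|<1\}$ and let $\mathcal{H}$ be the complex vector space of analytic functions on $\mathbb{D}$ with the topology of uniform convergence on compact subsets of $\mathbb{D}$. Let $\mathcal{U}$ be the class of functions $f\in\mathcal{H}$ with $f(0)=0$, $f'(0)=1$, $f(z)\neq 0$ for $z\in\mathbb{D}\setminus\{0\}$, and $$\left|f'(z)\left(\frac{z}{f(z)}\right)^2-1\right|<1\qquad (z\in\mathbb{D}),$$ where $z/f(z)$ is given its limit value $1$ at $z=0$. For $\mathcal{F}\subseteq\mathcal{H}$, a function $f\in\mathcal{F}$ is a support point of $\mathcal{F}$ if there is a continuous complex-linear functional $J:\mathcal{H}\to\mathbb{C}$ such that $\operatorname{Re}J$ is non-constant on $\mathcal{F}$ and $\operatorname{Re}J(f)=\max\{\operatorname{Re}J(g):g\in\mathcal{F}\}$; the set of support points is denoted $\operatorname{supp}\mathcal{F}$. Let $\overline{co}\,\mathcal{U}$ be the closed convex hull of $\mathcal{U}$ in $\mathcal{H}$ (the intersection of all closed convex sets containing $\mathcal{U}$), and let $E\overline{co}\,\mathcal{U}$ be the set of extreme points of $\overline{co}\,\mathcal{U}$.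 Then $$\operatorname{supp}\mathcal{U}=E\overline{co}\,\mathcal{U}=\left\{z\mapsto\frac{z}{(1-xz)^2} : x\in\mathbb{C},\ |x|=1\right\}.$$ -/

import Mathlib

/-- The open unit disk of the complex plane. -/
abbrev unitDisk : Set ℂ := Metric.ball (0 : ℂ) 1

/-- The values of a function on the unit disk, extended by zero to the whole plane. It is only
evaluated and differentiated at points of the disk, which is open. -/
noncomputable def diskExtend (f : unitDisk → ℂ) : ℂ → ℂ :=
  Function.extend Subtype.val f 0

/-- The complex vector space of analytic functions on the unit disk, as a subspace of
`C(unitDisk, ℂ)`. Its topology is the one induced by the compact-open topology, i.e. the topology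
of uniform convergence on compact subsets of the disk. -/
noncomputable def AnalyticDisk : Submodule ℂ C(unitDisk, ℂ) where
  carrier := {f | DifferentiableOn ℂ (diskExtend f) unitDisk}
  zero_mem' := by
    refine (differentiableOn_const (0 : ℂ)).congr fun z hz => ?_
    have e : ∀ k : unitDisk → ℂ, diskExtend k z = k ⟨z, hz⟩ := fun k =>
      Subtype.val_injective.extend_apply k 0 ⟨z, hz⟩
    simpa using e ⇑(0 : C(unitDisk, ℂ))
  add_mem' := by
    intro f g hf hg
    refine (DifferentiableOn.add hf hg).congr fun z hz => ?_
    have e : ∀ k : unitDisk → ℂ, diskExtend k z = k ⟨z, hz⟩ := fun k =>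
      Subtype.val_injective.extend_apply k 0 ⟨z, hz⟩
    simp [e]
  smul_mem' := by
    intro c f hf
    refine (DifferentiableOn.const_smul hf c).congr fun z hz => ?_
    have e : ∀ k : unitDisk → ℂ, diskExtend k z = k ⟨z, hz⟩ := fun k =>
      Subtype.val_injective.extend_apply k 0 ⟨z, hz⟩
    simp [e]

/-- The function on `ℂ` underlying an element of `AnalyticDisk` (zero off the disk). -/
noncomputable def diskEval (f : AnalyticDisk) : ℂ → ℂ :=
  diskExtend f.val

/-- The analytic functions on the disk normalized by `f 0 = 0` and `f' 0 = 1`. -/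
def classA : Set AnalyticDisk :=
  {f | diskEval f 0 = 0 ∧ deriv (diskEval f) 0 = 1}

/-- The normalized analytic functions, non-vanishing off the origin, that satisfy
`|f'(z) (z / f(z))² - 1| < 1` on the disk. At `z = 0` the expression `z / f(z)` has a removable
singularity with value `1 / f'(0) = 1`, where the inequality reads `|1 - 1| < 1`; so the condition
is imposed at the points `z ≠ 0`. -/
def classU : Set AnalyticDisk :=
  {f | f ∈ classA ∧ ∀ z ∈ unitDisk, z ≠ 0 →
    diskEval f z ≠ 0 ∧ ‖deriv (diskEval f) z * (z / diskEval f z) ^ 2 - 1‖ < 1}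

/-- The support points of a family `F`: the elements of `F` at which some continuous linear
functional `J`, with `Re J` non-constant on `F`, has its real part maximal over `F`. -/
def supportPoints (F : Set AnalyticDisk) : Set AnalyticDisk :=
  {f | f ∈ F ∧ ∃ J : AnalyticDisk →L[ℂ] ℂ,
    (∃ g ∈ F, ∃ h ∈ F, (J g).re ≠ (J h).re) ∧ ∀ g ∈ F, (J g).re ≤ (J f).re}

/-- The functions `z / (1 - x z)²` with `|x| = 1`. -/
def koebeFunctions : Set AnalyticDisk :=
  {f | ∃ x : ℂ, ‖x‖ = 1 ∧ ∀ z ∈ unitDisk, diskEval f z = z / (1 - x * z) ^ 2}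

/-! Write f in `classU` as z / s(z)² with s(0) = 1. Then f'(z/f)² = s² - 2zss', and Jack's lemma
applied to 1 - s shows that the defining inequality forces |1 - s| < 1. Hence q = 1/s has Re q >
1/2, and Herglotz's theorem puts q in the closed convex hull of the kernels 1/(1 - xz), |x| = 1.

Since f = zq² is quadratic in q, a functional J is controlled on `classU` by its values on z/((1 -
xz)(1 - yz)). Put G(w) = Σ wⁿ J(zⁿ), which converges beyond the unit circle. For x ≠ y that value is
(G(x) - G(y))/(x - y), while J of the Koebe function of x is G'(x). The mean value theorem on the
chord from y to x makes the real part of the quotient equal to Re G' at a point of the open disk.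
The maximum principle bounds it by the maximum of Re G' on the circle, strictly unless Re G' is
constant (`re_apply_shiftMul_cauchyKernel`). By Hahn–Banach, `classU` and the Koebe functions have
the same closed convex hull.

Milman's theorem leaves only Koebe functions as extreme points, and f ↦ x f(x̄/2) exposes each of
them. If Re J is non-constant and maximal at zq², the strict inequality forces q to be a single
kernel. -/

open Set Filter Topology Metric
open scoped Pointwise

/-! ### Closed convex hulls of compact sets and Milman's theorem. -/

section ConvexGeometry

protected theorem IsCompact.convexJoin {E : Type*} [AddCommGroup E] [Module ℝ E]
    [TopologicalSpace E] [ContinuousAdd E] [ContinuousSMul ℝ E]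
    {A B : Set E} (hA : IsCompact A) (hB : IsCompact B) : IsCompact (convexJoin ℝ A B) := by
  have h : convexJoin ℝ A B =
      (fun p : ℝ × E × E => (1 - p.1) • p.2.1 + p.1 • p.2.2) '' (Icc (0 : ℝ) 1 ×ˢ A ×ˢ B) := by
    ext x
    simp only [mem_convexJoin, segment_eq_image, mem_image, mem_prod, Prod.exists]
    constructor
    · rintro ⟨a, ha, b, hb, t, ht, rfl⟩
      exact ⟨t, a, b, ⟨ht, ha, hb⟩, rfl⟩
    · rintro ⟨t, a, b, ⟨ht, ha, hb⟩, rfl⟩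
      exact ⟨a, ha, b, hb, t, ht, rfl⟩
  rw [h]
  exact (isCompact_Icc.prod (hA.prod hB)).image (by fun_prop)

variable {E : Type*} [AddCommGroup E] [Module ℝ E] [UniformSpace E] [IsUniformAddGroup E]
  [ContinuousSMul ℝ E] [LocallyConvexSpace ℝ E] [CompleteSpace E]

/-- In a complete locally convex space the closed convex hull of a compact set is compact. -/
protected theorem IsCompact.closedConvexHull {C : Set E} (hC : IsCompact C) :
    IsCompact (closedConvexHull ℝ C) := by
  rw [closedConvexHull_eq_closure_convexHull]
  exact hC.totallyBounded.convexHull.closure.isCompact_of_isClosed isClosed_closure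

variable [T2Space E]

/-- An extreme point of the closed convex hull of the union of two compact sets lies in one of the
two closed convex hulls. -/
theorem mem_closedConvexHull_or_of_mem_extremePoints {A B : Set E} (hA : IsCompact A)
    (hB : IsCompact B) {f : E} (hf : f ∈ (closedConvexHull ℝ (A ∪ B)).extremePoints ℝ) :
    f ∈ closedConvexHull ℝ A ∨ f ∈ closedConvexHull ℝ B := by
  rcases A.eq_empty_or_nonempty with rfl | hA0
  · right; simpa using hf.1
  rcases B.eq_empty_or_nonempty with rfl | hB0
  · left; simpa using hf.1
  -- The join of the two compact hulls is compact and convex, so f lies on a segment between them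
  -- and, being extreme, is an endpoint.
  have hsub : closedConvexHull ℝ (A ∪ B) ⊆
      convexJoin ℝ (closedConvexHull ℝ A) (closedConvexHull ℝ B) := by
    refine closedConvexHull_min (union_subset ?_ ?_)
      (convex_closedConvexHull.convexJoin convex_closedConvexHull)
      (hA.closedConvexHull.convexJoin hB.closedConvexHull).isClosed
    · exact subset_closedConvexHull.trans
        (subset_convexJoin_left (hB0.mono subset_closedConvexHull))
    · exact subset_closedConvexHull.trans
        (subset_convexJoin_right (hA0.mono subset_closedConvexHull))
  obtain ⟨a, ha, b, hb, hab⟩ := mem_convexJoin.1 (hsub hf.1)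
  have ha' : a ∈ closedConvexHull ℝ (A ∪ B) := (closedConvexHull ℝ).monotone subset_union_left ha
  have hb' : b ∈ closedConvexHull ℝ (A ∪ B) := (closedConvexHull ℝ).monotone subset_union_right hb
  rcases (mem_extremePoints_iff_forall_segment.1 hf).2 a ha' b hb' hab with rfl | rfl
  · exact Or.inl ha
  · exact Or.inr hb

/-- **Milman's theorem**: the extreme points of the closed convex hull of a compact set belong to
the set. -/
protected theorem IsCompact.extremePoints_closedConvexHull_subset {C : Set E} (hC : IsCompact C) :
    (closedConvexHull ℝ C).extremePoints ℝ ⊆ C := by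
  intro f hf
  -- Splitting D along a finite cover by translates of V, one translate at a time, places f in the
  -- hull of one piece, hence in one translate.
  have key : ∀ V : Set E, Convex ℝ V → IsClosed V → ∀ t : Set E, t.Finite → ∀ D : Set E,
      IsCompact D → D ⊆ ⋃ c ∈ t, (c +ᵥ V) → f ∈ (closedConvexHull ℝ D).extremePoints ℝ →
      ∃ c ∈ t, f ∈ c +ᵥ V := by
    intro V hV hVc t ht
    induction t, ht using Set.Finite.induction_on with
    | empty =>
      intro D _ hD hfD
      have : D = ∅ := by simpa using hD
      subst this
      exact absurd (closedConvexHull_min (𝕜 := ℝ) (Subset.refl ∅) convex_empty isClosed_empty hfD.1)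
        (notMem_empty _)
    | @insert c t hct ht ih =>
      intro D hDc hD hfD
      have hcV : IsClosed (c +ᵥ V) := hVc.vadd c
      have htV : IsClosed (⋃ c ∈ t, (c +ᵥ V)) := ht.isClosed_biUnion fun c _ => hVc.vadd c
      have hU : D = (D ∩ (c +ᵥ V)) ∪ (D ∩ ⋃ c ∈ t, (c +ᵥ V)) := by
        rw [← inter_union_distrib_left, eq_comm, inter_eq_left]
        simpa using hD
      have hfD' := hfD
      rw [hU] at hfD'
      rcases mem_closedConvexHull_or_of_mem_extremePoints (hDc.inter_right hcV)
        (hDc.inter_right htV) hfD' with h | h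
      · exact ⟨c, mem_insert _ _,
          closedConvexHull_min inter_subset_right (hV.vadd c) hcV h⟩
      · obtain ⟨d, hd, hfd⟩ := ih _ (hDc.inter_right htV) inter_subset_right
          (inter_extremePoints_subset_extremePoints_of_subset
            ((closedConvexHull ℝ).monotone inter_subset_left) ⟨h, hfD⟩)
        exact ⟨d, mem_insert_of_mem _ hd, hfd⟩
  rw [← hC.isClosed.closure_eq, mem_closure_iff_nhds]
  intro W hW
  -- Reflected because f = c + v will give c = f - v, a point of the compact set inside W.
  have hW0 : (fun y => f - y) ⁻¹' W ∈ 𝓝 (0 : E) :=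
    (show Continuous fun y => f - y by fun_prop).continuousAt.preimage_mem_nhds (by simpa using hW)
  obtain ⟨V0, hV0, hV0c, hV0W⟩ := exists_mem_nhds_isClosed_subset hW0
  obtain ⟨V1, hV1, hV1c, hV1V⟩ :=
    (locallyConvexSpace_iff_exists_convex_subset_zero ℝ E).mp inferInstance V0 hV0
  have hVV : closure V1 ⊆ (fun y => f - y) ⁻¹' W := (closure_minimal hV1V hV0c).trans hV0W
  obtain ⟨t, htC, hCt⟩ := hC.elim_nhds_subcover (fun c => c +ᵥ closure V1) fun c _ => by
    have := vadd_mem_nhds_vadd c (mem_of_superset hV1 subset_closure)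
    simpa using this
  obtain ⟨c, hct, hfc⟩ := key (closure V1) hV1c.closure isClosed_closure t t.finite_toSet C hC
    (by simpa using hCt) hf
  obtain ⟨v, hv, hvf⟩ := mem_vadd_set.1 hfc
  refine ⟨c, ?_, htC c hct⟩
  have := hVV hv
  simpa [← hvf] using this

theorem ContinuousLinearMap.le_of_mem_closedConvexHull {E : Type*} [AddCommGroup E] [Module ℝ E]
    [TopologicalSpace E] (L : E →L[ℝ] ℝ) {C : Set E} {M : ℝ} (hM : ∀ c ∈ C, L c ≤ M) {f : E}
    (hf : f ∈ closedConvexHull ℝ C) : L f ≤ M :=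
  closedConvexHull_min (t := {f | L f ≤ M}) hM (convex_halfSpace_le L.toLinearMap.isLinear _)
    (isClosed_le L.continuous continuous_const) hf

/-- If a continuous linear functional has a unique maximizer on a compact set, then it has no other
maximizer on the closed convex hull. -/
protected theorem IsCompact.eq_of_mem_closedConvexHull_of_unique_max {C : Set E} (hC : IsCompact C)
    (L : E →L[ℝ] ℝ) {c f : E} (hL : ∀ y ∈ C, L y ≤ L f) (huniq : ∀ y ∈ C, L y = L f → y = c)
    (hf : f ∈ closedConvexHull ℝ C) : f = c := by
  have hle : ∀ y ∈ closedConvexHull ℝ C, L y ≤ L f := fun y hy =>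
    L.le_of_mem_closedConvexHull hL hy
  have hexp := ContinuousLinearMap.toExposed.isExposed (l := L) (A := closedConvexHull ℝ C)
  have hconv := hexp.convex convex_closedConvexHull
  have hcomp := hexp.isCompact hC.closedConvexHull
  have hfm : f ∈ L.toExposed (closedConvexHull ℝ C) := ⟨hf, hle⟩
  -- Extreme points of the maximal face are extreme in the hull, so lie in C by Milman; Krein–Milman
  -- then collapses the face to c.
  have hext : (L.toExposed (closedConvexHull ℝ C)).extremePoints ℝ ⊆ {c} := by
    intro y hy
    have hyC := hC.extremePoints_closedConvexHull_subset
      (hexp.isExtreme.extremePoints_subset_extremePoints hy)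
    exact huniq y hyC (le_antisymm (hL y hyC) (hy.1.2 f hf))
  rw [← closure_convexHull_extremePoints hcomp hconv] at hfm
  have := closure_mono (convexHull_mono hext) hfm
  simpa using this

end ConvexGeometry

/-! ### The space of analytic functions and its continuous functionals. -/

namespace AnalyticDisk

theorem diskExtend_apply (f : unitDisk → ℂ) (z : unitDisk) : diskExtend f z = f z :=
  Subtype.val_injective.extend_apply f 0 z

theorem diskEval_coe (f : AnalyticDisk) (z : unitDisk) : diskEval f z = f.1 z :=
  diskExtend_apply f.1 z

theorem differentiableOn_diskEval (f : AnalyticDisk) :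
    DifferentiableOn ℂ (diskEval f) unitDisk := f.2

theorem ext_diskEval {f g : AnalyticDisk} (h : ∀ z ∈ unitDisk, diskEval f z = diskEval g z) :
    f = g := by
  refine Subtype.ext (ContinuousMap.ext fun z => ?_)
  rw [← diskEval_coe, ← diskEval_coe, h z z.2]

theorem diskEval_add (f g : AnalyticDisk) {z : ℂ} (hz : z ∈ unitDisk) :
    diskEval (f + g) z = diskEval f z + diskEval g z := by
  lift z to unitDisk using hz
  simp [diskEval_coe]

theorem diskEval_sub (f g : AnalyticDisk) {z : ℂ} (hz : z ∈ unitDisk) :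
    diskEval (f - g) z = diskEval f z - diskEval g z := by
  lift z to unitDisk using hz
  simp [diskEval_coe]

theorem diskEval_smul (c : ℂ) (f : AnalyticDisk) {z : ℂ} (hz : z ∈ unitDisk) :
    diskEval (c • f) z = c * diskEval f z := by
  lift z to unitDisk using hz
  simp [diskEval_coe]

theorem diskEval_sum {ι : Type*} (s : Finset ι) (f : ι → AnalyticDisk) {z : ℂ}
    (hz : z ∈ unitDisk) : diskEval (∑ i ∈ s, f i) z = ∑ i ∈ s, diskEval (f i) z := by
  lift z to unitDisk using hz
  simp [diskEval_coe]

/-- The element of `AnalyticDisk` given by a function holomorphic on the disk. -/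
noncomputable def ofFun (g : ℂ → ℂ) (hg : DifferentiableOn ℂ g unitDisk) : AnalyticDisk :=
  ⟨⟨fun z => g z, continuousOn_iff_continuous_domRestrict.1 hg.continuousOn⟩,
    hg.congr fun z hz => diskExtend_apply (fun z : unitDisk => g z) ⟨z, hz⟩⟩

theorem diskEval_ofFun {g : ℂ → ℂ} (hg : DifferentiableOn ℂ g unitDisk) {z : ℂ}
    (hz : z ∈ unitDisk) : diskEval (ofFun g hg) z = g z := by
  lift z to unitDisk using hz
  rw [diskEval_coe]; rfl

/-- Currying: joint continuity gives continuity into the compact-open topology. -/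
theorem continuous_ofFun {X : Type*} [TopologicalSpace X] {F : X → ℂ → ℂ}
    (hF : ∀ x, DifferentiableOn ℂ (F x) unitDisk)
    (hc : Continuous fun p : X × unitDisk => F p.1 p.2) :
    Continuous fun x => ofFun (F x) (hF x) := by
  refine Continuous.subtype_mk ?_ _
  exact (ContinuousMap.curry ⟨fun p : X × unitDisk => F p.1 p.2, hc⟩).continuous

instance : LocallyCompactSpace unitDisk := isOpen_ball.locallyCompactSpace

/-- Weierstrass: locally uniform limits of holomorphic functions are holomorphic. This gives the
completeness that makes closed hulls of compact sets compact. -/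
theorem isClosed_carrier : IsClosed (AnalyticDisk : Set C(unitDisk, ℂ)) := by
  refine isClosed_of_closure_subset fun f hf => ?_
  obtain ⟨u, hu, huf⟩ := mem_closure_iff_seq_limit.1 hf
  rw [ContinuousMap.tendsto_iff_tendstoLocallyUniformly] at huf
  have : TendstoLocallyUniformlyOn (fun n => diskExtend (u n)) (diskExtend f) atTop unitDisk := by
    rw [tendstoLocallyUniformlyOn_iff_tendstoLocallyUniformly_comp_coe]
    refine (huf.congr (fun n z => ?_)).congr_right fun z => ?_
    · exact (diskExtend_apply _ _).symm
    · exact (diskExtend_apply _ _).symm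
  exact this.differentiableOn (Eventually.of_forall hu) isOpen_ball

instance : CompleteSpace AnalyticDisk := isClosed_carrier.completeSpace_coe

instance : IsUniformAddGroup AnalyticDisk :=
  IsUniformInducing.isUniformAddGroup
    ({ toFun := fun f => ContinuousMap.toUniformOnFunIsCompact f.1
       map_zero' := rfl
       map_add' := fun _ _ => rfl } :
      AnalyticDisk →+ UniformOnFun unitDisk ℂ {K | IsCompact K})
    (ContinuousMap.isUniformEmbedding_toUniformOnFunIsCompact.isUniformInducing.comp
      isUniformEmbedding_subtype_val.isUniformInducing)

instance : LocallyConvexSpace ℝ AnalyticDisk :=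
  Topology.IsInducing.subtypeVal.locallyConvexSpace
    (f := (AnalyticDisk.subtype.restrictScalars ℝ : AnalyticDisk →ₗ[ℝ] C(unitDisk, ℂ)))

instance : ContinuousSMul ℝ AnalyticDisk := IsScalarTower.continuousSMul ℂ

/-- The linear map `a ↦ z a(z) b(z)`. -/
noncomputable def shiftMul (b : AnalyticDisk) : AnalyticDisk →L[ℂ] AnalyticDisk where
  toFun a := ofFun (fun z => z * diskEval a z * diskEval b z)
    ((differentiableOn_id.mul (differentiableOn_diskEval a)).mul (differentiableOn_diskEval b))
  map_add' a a' := ext_diskEval fun z hz => by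
    rw [diskEval_add _ _ hz, diskEval_ofFun _ hz, diskEval_ofFun _ hz, diskEval_ofFun _ hz,
      diskEval_add _ _ hz]
    ring
  map_smul' c a := ext_diskEval fun z hz => by
    rw [RingHom.id_apply, diskEval_smul _ _ hz, diskEval_ofFun _ hz, diskEval_ofFun _ hz,
      diskEval_smul _ _ hz]
    ring
  cont := by
    refine continuous_ofFun _ ?_
    simp only [diskEval_coe]
    have h : Continuous fun p : AnalyticDisk × unitDisk => p.1.1 p.2 := by fun_prop
    exact ((continuous_subtype_val.comp continuous_snd).mul h).mul
      (b.1.continuous.comp continuous_snd)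

theorem diskEval_shiftMul (a b : AnalyticDisk) {z : ℂ} (hz : z ∈ unitDisk) :
    diskEval (shiftMul b a) z = z * diskEval a z * diskEval b z :=
  diskEval_ofFun _ hz

theorem shiftMul_comm (a b : AnalyticDisk) : shiftMul a b = shiftMul b a :=
  ext_diskEval fun z hz => by
    rw [diskEval_shiftMul _ _ hz, diskEval_shiftMul _ _ hz]; ring

/-- Evaluation at a point of the disk. -/
noncomputable def evalCLM (z : unitDisk) : AnalyticDisk →L[ℂ] ℂ :=
  (ContinuousMap.evalCLM ℂ z).comp AnalyticDisk.subtypeL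

theorem evalCLM_apply (z : unitDisk) (f : AnalyticDisk) : evalCLM z f = diskEval f z :=
  (diskEval_coe f z).symm

/-- A continuous linear functional is bounded by the supremum over a smaller disk. -/
theorem exists_norm_apply_le (J : AnalyticDisk →L[ℂ] ℂ) :
    ∃ ρ : ℝ, 0 < ρ ∧ ρ < 1 ∧ ∃ C : ℝ, 0 < C ∧ ∀ (f : AnalyticDisk) (B : ℝ), 0 < B →
      (∀ z : ℂ, ‖z‖ ≤ ρ → ‖diskEval f z‖ ≤ B) → ‖J f‖ ≤ C * B := by
  have h1 : {f : AnalyticDisk | ‖J f‖ < 1} ∈ 𝓝 (0 : AnalyticDisk) :=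
    (isOpen_lt (by fun_prop) continuous_const).mem_nhds (by simp)
  rw [nhds_subtype_eq_comap, mem_comap] at h1
  obtain ⟨U, hU, hUJ⟩ := h1
  obtain ⟨⟨K, ε⟩, ⟨hK, hε⟩, hKU⟩ := (nhds_basis_uniformity'
    (Metric.uniformity_basis_dist (α := ℂ)).compactConvergenceUniformity).mem_iff.1 hU
  obtain ⟨r, hr, hKr⟩ := exists_lt_subset_ball
    (hK.image continuous_subtype_val).isClosed (x := (0 : ℂ)) (r := 1) (by
      rintro _ ⟨z, -, rfl⟩; exact z.2)
  -- The maximum with 1/2 only keeps the radius positive.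
  refine ⟨max r (1 / 2), by positivity, max_lt hr (by norm_num), 2 / ε, by positivity,
    fun f B hB hf => ?_⟩
  have hε' : (0 : ℝ) < ε := hε
  have hmem : (((ε / (2 * B) : ℝ) : ℂ) • f) ∈ {f : AnalyticDisk | ‖J f‖ < 1} := by
    refine hUJ (hKU ?_)
    intro z hz
    have hzr : ‖(z : ℂ)‖ ≤ max r (1 / 2) := by
      have := hKr (mem_image_of_mem _ hz)
      rw [mem_ball_zero_iff] at this
      exact this.le.trans (le_max_left _ _)
    have hfz := hf z hzr
    rw [diskEval_coe] at hfz
    change dist (0 : ℂ) (((ε / (2 * B) : ℝ) : ℂ) * f.1 z) < ε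
    rw [dist_zero_left, norm_mul, Complex.norm_real, Real.norm_of_nonneg (by positivity)]
    calc ε / (2 * B) * ‖f.1 z‖ ≤ ε / (2 * B) * B := by gcongr
      _ = ε / 2 := by field_simp
      _ < ε := by linarith
  simp only [mem_ofPred_eq, map_smul, norm_smul, Complex.norm_real] at hmem
  rw [Real.norm_of_nonneg (by positivity), div_mul_eq_mul_div, div_lt_one (by positivity)] at hmem
  rw [div_mul_eq_mul_div, le_div_iff₀ hε']
  linarith

/-- The monomial `z ^ n`. -/
noncomputable def monomial (n : ℕ) : AnalyticDisk :=
  ofFun (fun z => z ^ n) (differentiableOn_id.pow n)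

theorem diskEval_monomial (n : ℕ) {z : ℂ} (hz : z ∈ unitDisk) :
    diskEval (monomial n) z = z ^ n :=
  diskEval_ofFun _ hz

theorem exists_norm_apply_monomial_le (J : AnalyticDisk →L[ℂ] ℂ) :
    ∃ ρ : ℝ, 0 < ρ ∧ ρ < 1 ∧ ∃ C : ℝ, 0 < C ∧ ∀ n, ‖J (monomial n)‖ ≤ C * ρ ^ n := by
  obtain ⟨ρ, hρ0, hρ1, C, hC, h⟩ := exists_norm_apply_le J
  refine ⟨ρ, hρ0, hρ1, C, hC, fun n => h _ _ (by positivity) fun z hz => ?_⟩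
  rw [diskEval_monomial n (mem_ball_zero_iff.2 (hz.trans_lt hρ1)), norm_pow]
  gcongr

/-- A continuous linear functional may be applied termwise to a power series. -/
theorem hasSum_apply (J : AnalyticDisk →L[ℂ] ℂ) {f : AnalyticDisk} {a : ℕ → ℂ}
    (h : ∀ z ∈ unitDisk, HasSum (fun n => a n * z ^ n) (diskEval f z)) :
    HasSum (fun n => a n * J (monomial n)) (J f) := by
  obtain ⟨ρ, hρ0, hρ1, C, hC, hJ⟩ := exists_norm_apply_le J
  have hball : ∀ z : ℂ, ‖z‖ ≤ ρ → z ∈ unitDisk := fun z hz =>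
    mem_ball_zero_iff.2 (hz.trans_lt hρ1)
  have hρz : ((ρ : ℝ) : ℂ) ∈ unitDisk :=
    hball _ (by rw [Complex.norm_real, Real.norm_of_nonneg hρ0.le])
  have hs : Summable fun n => ‖a n‖ * ρ ^ n := by
    simpa [abs_of_pos hρ0] using (h _ hρz).summable.norm
  have hmono : ∀ n, ‖J (monomial n)‖ ≤ C * ρ ^ n := fun n =>
    hJ _ _ (by positivity) fun z hz => by
      rw [diskEval_monomial n (hball z hz), norm_pow]
      gcongr
  have hs' : Summable fun n => ‖a n * J (monomial n)‖ := by
    refine Summable.of_nonneg_of_le (fun _ => norm_nonneg _) (fun n => ?_) (hs.mul_left C)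
    rw [norm_mul]
    calc ‖a n‖ * ‖J (monomial n)‖ ≤ ‖a n‖ * (C * ρ ^ n) := by gcongr; exact hmono n
      _ = C * (‖a n‖ * ρ ^ n) := by ring
  rw [hasSum_iff_tendsto_nat_of_summable_norm hs', tendsto_iff_norm_sub_tendsto_zero]
  have htail := tendsto_sum_nat_add fun n => ‖a n‖ * ρ ^ n
  -- The summand 1/(N + 1) keeps the bound strictly positive, as `hJ` requires, even when the tail
  -- vanishes.
  have hlim : Tendsto (fun N : ℕ => C * ((∑' k, ‖a (k + N)‖ * ρ ^ (k + N)) + 1 / ((N : ℝ) + 1)))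
      atTop (𝓝 0) := by
    simpa using (htail.add tendsto_one_div_add_atTop_nhds_zero_nat).const_mul C
  refine squeeze_zero (fun _ => norm_nonneg _) (fun N => ?_) hlim
  have hsum : ∑ n ∈ Finset.range N, a n * J (monomial n) =
      J (∑ n ∈ Finset.range N, a n • monomial n) := by
    simp
  rw [hsum, norm_sub_rev, ← map_sub]
  refine hJ _ _ ?_ fun z hz => ?_
  · have : 0 ≤ ∑' k, ‖a (k + N)‖ * ρ ^ (k + N) := tsum_nonneg fun _ => by positivity
    positivity
  · have hzb := hball z hz
    have hN : Summable fun k => ‖a (k + N)‖ * ρ ^ (k + N) := (summable_nat_add_iff N).2 hs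
    rw [diskEval_sub _ _ hzb, diskEval_sum _ _ hzb]
    have heq : diskEval f z - ∑ n ∈ Finset.range N, diskEval (a n • monomial n) z =
        ∑' k, a (k + N) * z ^ (k + N) := by
      rw [← (h z hzb).tsum_eq, ← (h z hzb).summable.sum_add_tsum_nat_add N, add_sub_right_comm]
      simp [diskEval_smul _ _ hzb, diskEval_monomial _ hzb]
    rw [heq]
    have hle : ∀ k, ‖a (k + N) * z ^ (k + N)‖ ≤ ‖a (k + N)‖ * ρ ^ (k + N) := fun k => by
      rw [norm_mul, norm_pow]; gcongr
    have hb := tsum_of_norm_bounded hN.hasSum hle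
    have : (0 : ℝ) ≤ 1 / ((N : ℝ) + 1) := by positivity
    linarith

/-! ### Cauchy kernels, Koebe functions and the generating function of a functional. -/

theorem norm_mul_lt_one (x : sphere (0 : ℂ) 1) {z : ℂ} (hz : z ∈ unitDisk) : ‖(x : ℂ) * z‖ < 1 := by
  have hx : ‖(x : ℂ)‖ = 1 := mem_sphere_zero_iff_norm.1 x.2
  rw [norm_mul, hx, one_mul]
  exact mem_ball_zero_iff.1 hz

theorem one_sub_mul_ne_zero (x : sphere (0 : ℂ) 1) {z : ℂ} (hz : z ∈ unitDisk) :
    1 - (x : ℂ) * z ≠ 0 := by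
  intro h
  have := norm_mul_lt_one x hz
  rw [← sub_eq_zero.1 h] at this
  simp at this

theorem differentiableOn_cauchyKernel (x : sphere (0 : ℂ) 1) :
    DifferentiableOn ℂ (fun z => (1 - (x : ℂ) * z)⁻¹) unitDisk :=
  DifferentiableOn.inv (by fun_prop) fun _ hz => one_sub_mul_ne_zero x hz

/-- The function `1 / (1 - x z)`. -/
noncomputable def cauchyKernel (x : sphere (0 : ℂ) 1) : AnalyticDisk :=
  ofFun (fun z => (1 - (x : ℂ) * z)⁻¹) (differentiableOn_cauchyKernel x)

theorem diskEval_cauchyKernel (x : sphere (0 : ℂ) 1) {z : ℂ} (hz : z ∈ unitDisk) :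
    diskEval (cauchyKernel x) z = (1 - x * z)⁻¹ :=
  diskEval_ofFun _ hz

theorem continuous_cauchyKernel : Continuous cauchyKernel := by
  refine continuous_ofFun _ (Continuous.inv₀ (by fun_prop) fun p => ?_)
  exact one_sub_mul_ne_zero p.1 p.2.2

theorem isCompact_range_cauchyKernel : IsCompact (range cauchyKernel) :=
  isCompact_range continuous_cauchyKernel

theorem differentiableOn_koebe (x : sphere (0 : ℂ) 1) :
    DifferentiableOn ℂ (fun z => z / (1 - (x : ℂ) * z) ^ 2) unitDisk :=
  DifferentiableOn.div (by fun_prop) (by fun_prop) fun _ hz =>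
    pow_ne_zero 2 (one_sub_mul_ne_zero x hz)

/-- The rotated Koebe function `z / (1 - x z)²`. -/
noncomputable def koebe (x : sphere (0 : ℂ) 1) : AnalyticDisk :=
  ofFun (fun z => z / (1 - (x : ℂ) * z) ^ 2) (differentiableOn_koebe x)

theorem diskEval_koebe (x : sphere (0 : ℂ) 1) {z : ℂ} (hz : z ∈ unitDisk) :
    diskEval (koebe x) z = z / (1 - x * z) ^ 2 :=
  diskEval_ofFun _ hz

theorem continuous_koebe : Continuous koebe := by
  refine continuous_ofFun _ (Continuous.div (by fun_prop) (by fun_prop) fun p => ?_)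
  exact pow_ne_zero 2 (one_sub_mul_ne_zero p.1 p.2.2)

theorem isCompact_range_koebe : IsCompact (range koebe) :=
  isCompact_range continuous_koebe

theorem koebeFunctions_eq_range : koebeFunctions = range koebe := by
  ext f
  constructor
  · rintro ⟨x, hx, h⟩
    exact ⟨⟨x, mem_sphere_zero_iff_norm.2 hx⟩, ext_diskEval fun z hz => by
      rw [diskEval_koebe _ hz, h z hz]⟩
  · rintro ⟨x, rfl⟩
    exact ⟨x, mem_sphere_zero_iff_norm.1 x.2, fun z hz => diskEval_koebe x hz⟩

theorem shiftMul_cauchyKernel_self (x : sphere (0 : ℂ) 1) :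
    shiftMul (cauchyKernel x) (cauchyKernel x) = koebe x :=
  ext_diskEval fun z hz => by
    rw [diskEval_shiftMul _ _ hz, diskEval_cauchyKernel _ hz, diskEval_koebe _ hz]
    have := one_sub_mul_ne_zero x hz
    field_simp

/-- Partial fractions; this makes J of a product of two kernels a divided difference of the
generating function. -/
theorem smul_shiftMul_cauchyKernel (x y : sphere (0 : ℂ) 1) :
    ((x : ℂ) - y) • shiftMul (cauchyKernel y) (cauchyKernel x) =
      cauchyKernel x - cauchyKernel y :=
  ext_diskEval fun z hz => by
    rw [diskEval_smul _ _ hz, diskEval_shiftMul _ _ hz, diskEval_sub _ _ hz,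
      diskEval_cauchyKernel _ hz, diskEval_cauchyKernel _ hz]
    have := one_sub_mul_ne_zero x hz
    have := one_sub_mul_ne_zero y hz
    field_simp
    ring

theorem hasSum_apply_cauchyKernel (J : AnalyticDisk →L[ℂ] ℂ) (x : sphere (0 : ℂ) 1) :
    HasSum (fun n => (x : ℂ) ^ n * J (monomial n)) (J (cauchyKernel x)) := by
  refine hasSum_apply J fun z hz => ?_
  rw [diskEval_cauchyKernel _ hz]
  simpa [mul_pow] using hasSum_geometric_of_norm_lt_one (norm_mul_lt_one x hz)

theorem hasSum_apply_koebe (J : AnalyticDisk →L[ℂ] ℂ) (x : sphere (0 : ℂ) 1) :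
    HasSum (fun n : ℕ => ((n : ℂ) * (x : ℂ) ^ (n - 1)) * J (monomial n)) (J (koebe x)) := by
  have hx : (x : ℂ) ≠ 0 := by
    intro h
    simpa [h] using mem_sphere_zero_iff_norm.1 x.2
  refine hasSum_apply J fun z hz => ?_
  rw [diskEval_koebe _ hz]
  have h := (hasSum_coe_mul_geometric_of_norm_lt_one (norm_mul_lt_one x hz)).mul_left (x : ℂ)⁻¹
  have h1 : z / (1 - x * z) ^ 2 = (x : ℂ)⁻¹ * (x * z / (1 - x * z) ^ 2) := by
    field_simp
  -- At n = 0 the truncated exponent is harmless, since the factor n vanishes.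
  have h2 : (fun n : ℕ => (n : ℂ) * (x : ℂ) ^ (n - 1) * z ^ n) =
      fun n : ℕ => (x : ℂ)⁻¹ * (n * (x * z) ^ n) := by
    ext n
    rcases n with _ | n
    · simp
    · simp only [Nat.add_sub_cancel, mul_pow, pow_succ (x : ℂ) n]
      field_simp
  rw [h1, h2]
  exact h

/-- The generating function of the moments of a continuous linear functional extends
holomorphically across the unit circle; it computes the functional on the kernels. -/
theorem exists_generatingFunction (J : AnalyticDisk →L[ℂ] ℂ) :
    ∃ G : ℂ → ℂ, ∃ R : ℝ, 1 < R ∧ DifferentiableOn ℂ G (ball 0 R) ∧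
      (∀ x, J (cauchyKernel x) = G x) ∧ ∀ x, J (koebe x) = deriv G x := by
  obtain ⟨ρ, hρ0, hρ1, C, hC, hJ⟩ := exists_norm_apply_monomial_le J
  -- Any R strictly between 1 and 1/ρ would do.
  set R : ℝ := 2 / (1 + ρ)
  have hR : 1 < R := by rw [lt_div_iff₀ (by positivity)]; linarith
  have hρR : ρ * R < 1 := by
    rw [← mul_div_assoc, div_lt_one (by positivity)]; linarith
  have hu : Summable fun n : ℕ => C * (ρ * R) ^ n :=
    (summable_geometric_of_lt_one (by positivity) hρR).mul_left C
  have hd : ∀ n : ℕ, DifferentiableOn ℂ (fun w : ℂ => w ^ n * J (monomial n)) (ball 0 R) :=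
    fun n => by fun_prop
  have hb : ∀ (n : ℕ) (w : ℂ), w ∈ ball (0 : ℂ) R →
      ‖w ^ n * J (monomial n)‖ ≤ C * (ρ * R) ^ n := fun n w hw => by
    have hw' : ‖w‖ ≤ R := (mem_ball_zero_iff.1 hw).le
    rw [norm_mul, norm_pow]
    calc ‖w‖ ^ n * ‖J (monomial n)‖ ≤ R ^ n * (C * ρ ^ n) := by gcongr; exact hJ n
      _ = C * (ρ * R) ^ n := by rw [mul_pow]; ring
  have hxR : ∀ x : sphere (0 : ℂ) 1, (x : ℂ) ∈ ball (0 : ℂ) R := fun x => by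
    rw [mem_ball_zero_iff, mem_sphere_zero_iff_norm.1 x.2]; exact hR
  refine ⟨fun w => ∑' n : ℕ, w ^ n * J (monomial n), R, hR,
    Complex.differentiableOn_tsum_of_summable_norm hu hd isOpen_ball hb,
    fun x => (hasSum_apply_cauchyKernel J x).tsum_eq.symm, fun x => ?_⟩
  refine (hasSum_apply_koebe J x).unique ?_
  have h := Complex.hasSum_deriv_of_summable_norm hu hd isOpen_ball hb (hxR x)
  simpa using h

/-- If `Re J ≤ M` on the Koebe functions, then `Re J ≤ M` on the functions
`z / ((1 - x z) (1 - y z))`, with strict inequality for `x ≠ y` unless `Re J = M` on all Koebe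
functions. -/
theorem re_apply_shiftMul_cauchyKernel (J : AnalyticDisk →L[ℂ] ℂ) {M : ℝ}
    (hM : ∀ x, (J (koebe x)).re ≤ M) {x y : sphere (0 : ℂ) 1} (hxy : x ≠ y) :
    (J (shiftMul (cauchyKernel y) (cauchyKernel x))).re ≤ M ∧
      ((∃ w, (J (koebe w)).re ≠ M) → (J (shiftMul (cauchyKernel y) (cauchyKernel x))).re < M) := by
  obtain ⟨G, R, hR, hG, hGc, hGk⟩ := exists_generatingFunction J
  have hsub : closedBall (0 : ℂ) 1 ⊆ ball 0 R := closedBall_subset_ball hR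
  have hGd := hG.deriv isOpen_ball
  -- |exp G'| = exp(Re G') turns the maximum modulus principle into one for Re G'.
  have hE : DiffContOnCl ℂ (fun s => Complex.exp (deriv G s)) (ball 0 1) := by
    refine DifferentiableOn.diffContOnCl ?_
    rw [closure_ball _ one_ne_zero]
    exact (hGd.mono hsub).cexp
  have hsph : ∀ s : ℂ, ‖s‖ = 1 → (deriv G s).re ≤ M := fun s hs => by
    have := hM ⟨s, mem_sphere_zero_iff_norm.2 hs⟩
    rwa [hGk] at this
  have hle : ∀ s ∈ closedBall (0 : ℂ) 1, (deriv G s).re ≤ M := by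
    intro s hs
    have := Complex.norm_le_of_forall_mem_frontier_norm_le isBounded_ball hE (C := Real.exp M)
      (fun w hw => by
        rw [frontier_ball _ one_ne_zero, mem_sphere_zero_iff_norm] at hw
        rw [Complex.norm_exp]
        exact Real.exp_le_exp.2 (hsph w hw)) (z := s) (by rwa [closure_ball _ one_ne_zero])
    rwa [Complex.norm_exp, Real.exp_le_exp] at this
  have hlt : (∃ w, (J (koebe w)).re ≠ M) → ∀ s ∈ ball (0 : ℂ) 1, (deriv G s).re < M := by
    rintro ⟨w, hw⟩ s hs
    refine lt_of_le_of_ne (hle s (ball_subset_closedBall hs)) fun hsM => hw ?_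
    have hmax : IsMaxOn (norm ∘ fun s => Complex.exp (deriv G s)) (ball 0 1) s := by
      intro t ht
      simp only [Function.comp_apply, Complex.norm_exp, mem_ofPred_eq, Real.exp_le_exp, hsM]
      exact hle t (ball_subset_closedBall ht)
    have := Complex.norm_eqOn_closure_of_isPreconnected_of_isMaxOn
      (convex_ball (0 : ℂ) 1).isPreconnected isOpen_ball hE hs hmax
      (x := (w : ℂ)) (by rw [closure_ball _ one_ne_zero]; exact sphere_subset_closedBall w.2)
    simp only [Function.comp_apply, Function.const_apply, Complex.norm_exp,
      Real.exp_eq_exp] at this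
    rw [hGk, this, hsM]
  have hne : (x : ℂ) - y ≠ 0 := sub_ne_zero.2 fun h => hxy (Subtype.ext h)
  have hq : J (shiftMul (cauchyKernel y) (cauchyKernel x)) = (G x - G y) / (x - y) := by
    rw [eq_div_iff hne, ← hGc, ← hGc, ← map_sub, ← smul_shiftMul_cauchyKernel, map_smul,
      smul_eq_mul, mul_comm]
  set γ : ℝ → ℂ := fun t => y + t * (x - y)
  -- Strict convexity puts the open chord inside the open disk, where the strict bound holds.
  have hγ : ∀ t ∈ Ioo (0 : ℝ) 1, γ t ∈ ball (0 : ℂ) 1 := by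
    intro t ht
    have := (strictConvex_closedBall ℝ (0 : ℂ) 1) (sphere_subset_closedBall y.2)
      (sphere_subset_closedBall x.2) (fun h => hxy (Subtype.ext h.symm))
      (sub_pos.2 ht.2) ht.1 (by ring)
    rw [interior_closedBall _ one_ne_zero] at this
    convert this using 1
    simp only [γ, Complex.real_smul]
    push_cast
    ring
  have hγ' : ∀ t ∈ Icc (0 : ℝ) 1, γ t ∈ closedBall (0 : ℂ) 1 := by
    intro t ht
    have := (convex_closedBall (0 : ℂ) 1) (sphere_subset_closedBall y.2)
      (sphere_subset_closedBall x.2) (sub_nonneg.2 ht.2) ht.1 (by ring)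
    convert this using 1
    simp only [γ, Complex.real_smul]
    push_cast
    ring
  -- Dividing by x - y = γ' leaves exactly Re G' as derivative, so the real mean value theorem
  -- applies.
  have hder : ∀ t ∈ Icc (0 : ℝ) 1,
      HasDerivAt (fun t : ℝ => (G (γ t) / (x - y)).re) (deriv G (γ t)).re t := by
    intro t ht
    have h1 : HasDerivAt G (deriv G (γ t)) (γ t) :=
      (hG.differentiableAt (isOpen_ball.mem_nhds (hsub (hγ' t ht)))).hasDerivAt
    have h2 : HasDerivAt γ ((x : ℂ) - y) t := by
      simpa [γ] using (((hasDerivAt_id t).ofReal_comp).mul_const ((x : ℂ) - y)).const_add (y : ℂ)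
    have h3 := (h1.comp t h2).div_const ((x : ℂ) - y)
    rw [mul_div_cancel_right₀ _ hne] at h3
    exact Complex.reCLM.hasFDerivAt.comp_hasDerivAt t h3
  obtain ⟨c, hc, hcd⟩ := exists_hasDerivAt_eq_slope _ (fun t => (deriv G (γ t)).re)
    (zero_lt_one (α := ℝ)) (fun t ht => (hder t ht).continuousAt.continuousWithinAt)
    (fun t ht => hder t (Ioo_subset_Icc_self ht))
  have hval : (J (shiftMul (cauchyKernel y) (cauchyKernel x))).re = (deriv G (γ c)).re := by
    rw [hcd, hq]
    simp [γ, sub_div]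
  rw [hval]
  exact ⟨hle _ (ball_subset_closedBall (hγ c hc)), fun h => hlt h _ (hγ c hc)⟩

end AnalyticDisk

/-! ### Circle averages and the Herglotz theorem. -/

open Real in
theorem DifferentiableOn.circleAverage_mul_inv_pow {q : ℂ → ℂ}
    (hq : DifferentiableOn ℂ q (closedBall 0 1)) (n : ℕ) :
    circleAverage (fun x => q x * x⁻¹ ^ n) 0 1 = (n.factorial : ℂ)⁻¹ * iteratedDeriv n q 0 := by
  have h := hq.circleIntegral_one_div_sub_center_pow_smul one_pos n
  rw [circleAverage_eq_circleIntegral one_ne_zero]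
  have h' : (∮ z in C(0, 1), (z - 0)⁻¹ • (q z * z⁻¹ ^ n)) =
      ∮ z in C(0, 1), (1 / (z - 0) ^ (n + 1)) • q z := by
    congr 1
    ext z
    simp only [sub_zero, smul_eq_mul, one_div, inv_pow, pow_succ, mul_inv]
    ring
  rw [h', h]
  have : (2 * π * Complex.I : ℂ) ≠ 0 := Complex.two_pi_I_ne_zero
  simp only [smul_eq_mul]
  field_simp

-- On the circle x⁻¹ = x̄, so the integrand is the conjugate of q xⁿ, whose mean is its value 0 at
-- the origin.
open Real ComplexConjugate in
theorem DifferentiableOn.circleAverage_conj_mul_inv_pow {q : ℂ → ℂ}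
    (hq : DifferentiableOn ℂ q (closedBall 0 1)) (h0 : q 0 = 0) (n : ℕ) :
    circleAverage (fun x => conj (q x) * x⁻¹ ^ n) 0 1 = 0 := by
  have hd : DifferentiableOn ℂ (fun x => q x * x ^ n) (closedBall 0 1) :=
    hq.mul (by fun_prop)
  have hd' : DiffContOnCl ℂ (fun x => q x * x ^ n) (ball 0 |1|) := by
    rw [abs_one]
    exact (hd.mono closure_ball_subset_closedBall).diffContOnCl
  have hint : CircleIntegrable (fun x => q x * x ^ n) 0 1 :=
    ContinuousOn.circleIntegrable zero_le_one (hd.continuousOn.mono sphere_subset_closedBall)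
  have h1 := (Complex.conjCLE : ℂ →L[ℝ] ℂ).circleAverage_comp_comm hint
  rw [hd'.circleAverage, h0] at h1
  rw [← circleAverage_congr_sphere (f₁ := (Complex.conjCLE : ℂ →L[ℝ] ℂ) ∘ fun x => q x * x ^ n)]
  · simpa using h1
  · intro x hx
    have hx1 : ‖x‖ = 1 := by simpa using hx
    simp [Complex.inv_def, Complex.normSq_eq_norm_sq, hx1]

namespace AnalyticDisk

open Real ComplexConjugate in
/-- A function holomorphic on the closed disk with `q 0 = 1` and `Re q ≥ 1 / 2` is a mean of the
functions `1 / (1 - x z)` with respect to the weight `2 Re q - 1`. -/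
theorem re_apply_le_of_half_le_re (J : AnalyticDisk →L[ℂ] ℂ) {u : ℝ}
    (hu : ∀ x, (J (cauchyKernel x)).re ≤ u) {q : ℂ → ℂ}
    (hq : DifferentiableOn ℂ q (closedBall 0 1)) (h0 : q 0 = 1)
    (hre : ∀ z ∈ closedBall (0 : ℂ) 1, 1 / 2 ≤ (q z).re) :
    (J (ofFun q (hq.mono ball_subset_closedBall))).re ≤ u := by
  obtain ⟨G, R, hR, hG, hGc, -⟩ := exists_generatingFunction J
  obtain ⟨ρ, hρ0, hρ1, C, hC, hJ⟩ := exists_norm_apply_monomial_le J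
  have hqc : ContinuousOn q (sphere 0 1) := hq.continuousOn.mono sphere_subset_closedBall
  set W : ℂ → ℝ := fun x => 2 * (q x).re - 1 with hW
  have hWc : ContinuousOn W (sphere 0 1) :=
    (continuousOn_const.mul (Complex.continuous_re.comp_continuousOn hqc)).sub continuousOn_const
  have hW0 : ∀ x ∈ sphere (0 : ℂ) 1, 0 ≤ W x := fun x hx => by
    have := hre x (sphere_subset_closedBall hx)
    simp only [hW]; linarith
  have hinv : ∀ x ∈ sphere (0 : ℂ) 1, x⁻¹ ∈ sphere (0 : ℂ) 1 := fun x hx => by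
    rw [mem_sphere_zero_iff_norm] at hx ⊢; rw [norm_inv, hx, inv_one]
  have hne : ∀ x ∈ sphere (0 : ℂ) 1, x ≠ 0 := fun x hx h => by
    rw [mem_sphere_zero_iff_norm, h, norm_zero] at hx; exact zero_ne_one hx
  have hinvc : ContinuousOn (fun x : ℂ => x⁻¹) (sphere 0 1) := continuousOn_inv₀.mono hne
  have hGi : ContinuousOn (fun x => G x⁻¹) (sphere 0 1) := by
    refine (hG.continuousOn.mono ?_).comp hinvc hinv
    exact sphere_subset_closedBall.trans (closedBall_subset_ball hR)
  have hGu : ∀ x ∈ sphere (0 : ℂ) 1, (G x⁻¹).re ≤ u := fun x hx => by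
    have := hu ⟨x⁻¹, hinv x hx⟩
    rwa [hGc] at this
  -- W = q + conj(q - 1), and the conjugate part contributes nothing. The case n = 0 gives W mean 1,
  -- so W is a probability density on the circle.
  have hWcoef : ∀ n : ℕ, circleAverage (fun x => (W x : ℂ) * x⁻¹ ^ n) 0 1 =
      (n.factorial : ℂ)⁻¹ * iteratedDeriv n q 0 := fun n => by
    have hs : (fun x => (W x : ℂ) * x⁻¹ ^ n) =
        fun x => q x * x⁻¹ ^ n + conj (q x - 1) * x⁻¹ ^ n := by
      ext x
      have : (q x + conj (q x) : ℂ) = ((2 * (q x).re : ℝ) : ℂ) := Complex.add_conj _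
      simp only [hW, map_sub, map_one, Complex.ofReal_sub, Complex.ofReal_one, ← this]
      ring
    rw [hs, circleAverage_fun_add, hq.circleAverage_mul_inv_pow n,
      DifferentiableOn.circleAverage_conj_mul_inv_pow (q := fun x => q x - 1)
        (hq.sub_const 1) (by simp [h0]), add_zero]
    · exact ContinuousOn.circleIntegrable zero_le_one (hqc.mul (hinvc.pow n))
    · exact ContinuousOn.circleIntegrable zero_le_one
        ((Complex.continuous_conj.comp_continuousOn (hqc.sub continuousOn_const)).mul
          (hinvc.pow n))
  obtain ⟨B, hB⟩ := (isCompact_sphere (0 : ℂ) 1).exists_bound_of_continuousOn hWc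
  have hmem : ∀ θ : ℝ, circleMap 0 1 θ ∈ sphere (0 : ℂ) 1 := fun θ =>
    circleMap_mem_sphere 0 zero_le_one θ
  have hsum : HasSum (fun n : ℕ => (n.factorial : ℂ)⁻¹ * iteratedDeriv n q 0 * J (monomial n))
      (circleAverage (fun x => (W x : ℂ) * G x⁻¹) 0 1) := by
    have hcm : Continuous (circleMap 0 1) := continuous_circleMap 0 1
    have hI := intervalIntegral.hasSum_integral_of_dominated_convergence
      (μ := MeasureTheory.volume) (a := 0) (b := 2 * π)
      (F := fun (n : ℕ) θ => (W (circleMap 0 1 θ) : ℂ) *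
        ((circleMap 0 1 θ)⁻¹ ^ n * J (monomial n)))
      (f := fun θ => (W (circleMap 0 1 θ) : ℂ) * G (circleMap 0 1 θ)⁻¹)
      (fun n _ => B * (C * ρ ^ n)) ?_ ?_ ?_ ?_ ?_
    · have hI' := hI.const_smul (2 * π)⁻¹
      rw [circleAverage_def]
      have he : (fun n : ℕ => (n.factorial : ℂ)⁻¹ * iteratedDeriv n q 0 * J (monomial n)) =
          fun n : ℕ => (2 * π)⁻¹ • ∫ θ in (0)..(2 * π), (W (circleMap 0 1 θ) : ℂ) *
            ((circleMap 0 1 θ)⁻¹ ^ n * J (monomial n)) := by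
        ext n
        simp only [← mul_assoc]
        rw [← hWcoef n, circleAverage_def, intervalIntegral.integral_mul_const, smul_mul_assoc]
      rw [he]
      exact hI'
    · intro n
      refine Continuous.aestronglyMeasurable ?_
      refine Continuous.mul (Complex.continuous_ofReal.comp (hWc.comp_continuous hcm hmem)) ?_
      exact ((hinvc.comp_continuous hcm hmem).pow n).mul continuous_const
    · refine fun n => Eventually.of_forall fun θ _ => ?_
      have h1 : ‖circleMap 0 1 θ‖ = 1 := by simp
      rw [norm_mul, norm_mul, norm_pow, norm_inv, h1, inv_one, one_pow, one_mul, Complex.norm_real]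
      have := hB _ (hmem θ)
      gcongr
      · exact (norm_nonneg _).trans this
      · exact hJ n
    · exact Eventually.of_forall fun θ _ =>
        ((summable_geometric_of_lt_one hρ0.le hρ1).mul_left C).mul_left B
    · exact intervalIntegrable_const
    · refine Eventually.of_forall fun θ _ => HasSum.mul_left _ ?_
      have := hasSum_apply_cauchyKernel J ⟨_, hinv _ (hmem θ)⟩
      rwa [hGc] at this
  have hJq : J (ofFun q (hq.mono ball_subset_closedBall)) =
      circleAverage (fun x => (W x : ℂ) * G x⁻¹) 0 1 := by
    refine (hasSum_apply J fun z hz => ?_).unique hsum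
    rw [diskEval_ofFun _ hz]
    have := Complex.hasSum_taylorSeries_on_ball (hq.mono ball_subset_closedBall) hz
    simpa [mul_assoc, mul_comm, mul_left_comm] using this
  have hint : CircleIntegrable (fun x => (W x : ℂ) * G x⁻¹) 0 1 :=
    ContinuousOn.circleIntegrable zero_le_one
      ((Complex.continuous_ofReal.comp_continuousOn hWc).mul hGi)
  have hre' := Complex.reCLM.circleAverage_comp_comm hint
  rw [hJq, ← Complex.reCLM_apply, ← hre']
  have hW1 : circleAverage W 0 1 = 1 := by
    have h := hWcoef 0
    have h2 := Complex.ofRealCLM.circleAverage_comp_comm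
      (ContinuousOn.circleIntegrable zero_le_one hWc)
    simp only [pow_zero, mul_one, Nat.factorial_zero, Nat.cast_one, inv_one,
      iteratedDeriv_zero, h0] at h
    have h3 : Complex.ofRealCLM (circleAverage W 0 1) = 1 := by
      rw [← h2, ← h]; rfl
    simpa using h3
  calc circleAverage (Complex.reCLM ∘ fun x => (W x : ℂ) * G x⁻¹) 0 1
      ≤ circleAverage (fun x => u • W x) 0 1 := by
        refine circleAverage_mono ?_ ?_ ?_
        · exact ContinuousOn.circleIntegrable zero_le_one
            (Complex.reCLM.continuous.comp_continuousOn
              ((Complex.continuous_ofReal.comp_continuousOn hWc).mul hGi))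
        · exact ContinuousOn.circleIntegrable zero_le_one (hWc.const_smul u)
        · intro x hx
          rw [abs_one] at hx
          simp only [Function.comp_apply, Complex.reCLM_apply, Complex.re_ofReal_mul, smul_eq_mul]
          rw [mul_comm u]
          exact mul_le_mul_of_nonneg_left (hGu x hx) (hW0 x hx)
    _ = u := by rw [circleAverage_fun_smul, hW1, smul_eq_mul, mul_one]

/-- **Herglotz**: a function with `q 0 = 1` and `Re q ≥ 1 / 2` lies in the closed convex hull of the
functions `1 / (1 - x z)`. -/
theorem mem_closedConvexHull_cauchyKernel {q : AnalyticDisk} (h0 : diskEval q 0 = 1)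
    (hre : ∀ z ∈ unitDisk, 1 / 2 ≤ (diskEval q z).re) :
    q ∈ closedConvexHull ℝ (range cauchyKernel) := by
  -- The dilations q(rz) with r < 1 are holomorphic on the closed disk, so averages apply to them; r
  -- → 1 recovers q.
  have hmaps : ∀ r : Icc (0 : ℝ) 1, MapsTo (fun z : ℂ => (r : ℂ) * z) unitDisk unitDisk := by
    intro r z hz
    rw [mem_ball_zero_iff] at hz ⊢
    rw [norm_mul, Complex.norm_real, Real.norm_of_nonneg r.2.1]
    exact (mul_le_of_le_one_left (norm_nonneg z) r.2.2).trans_lt hz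
  have hd : ∀ r : Icc (0 : ℝ) 1, DifferentiableOn ℂ (fun z => diskEval q (r * z)) unitDisk :=
    fun r => (differentiableOn_diskEval q).comp (by fun_prop) (hmaps r)
  have hcont : Continuous fun r => ofFun _ (hd r) := by
    refine continuous_ofFun _ ?_
    refine (differentiableOn_diskEval q).continuousOn.comp_continuous (by fun_prop) fun p => ?_
    exact hmaps p.1 p.2.2
  have hlt : ∀ r : Icc (0 : ℝ) 1, (r : ℝ) < 1 →
      ofFun _ (hd r) ∈ closedConvexHull ℝ (range cauchyKernel) := by
    intro r hr
    by_contra hnot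
    obtain ⟨J, u, hJ, hu⟩ := RCLike.geometric_hahn_banach_closed_point (𝕜 := ℂ)
      convex_closedConvexHull isClosed_closedConvexHull hnot
    have hmaps' : MapsTo (fun z : ℂ => (r : ℂ) * z) (closedBall 0 1) unitDisk := by
      intro z hz
      rw [mem_closedBall_zero_iff] at hz
      rw [mem_ball_zero_iff, norm_mul, Complex.norm_real, Real.norm_of_nonneg r.2.1]
      exact (mul_le_of_le_one_right r.2.1 hz).trans_lt hr
    refine hu.not_ge (re_apply_le_of_half_le_re J
      (fun x => (hJ _ (subset_closedConvexHull (mem_range_self x))).le)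
      (q := fun z => diskEval q (r * z))
      ((differentiableOn_diskEval q).comp (by fun_prop) hmaps') (by simpa using h0)
      fun z hz => hre _ (hmaps' hz))
  set r : ℕ → Icc (0 : ℝ) 1 := fun n => ⟨n / (n + 1), by positivity,
    div_le_one_of_le₀ (by linarith) (by positivity)⟩
  have hr : Tendsto r atTop (𝓝 1) := by
    rw [tendsto_subtype_rng]
    exact tendsto_natCast_div_add_atTop (1 : ℝ)
  have hlim := (hcont.tendsto 1).comp hr
  have hone : ofFun _ (hd 1) = q := ext_diskEval fun z hz => by
    rw [diskEval_ofFun _ hz]; simp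
  rw [hone] at hlim
  refine isClosed_closedConvexHull.mem_of_tendsto hlim (Eventually.of_forall fun n => hlt _ ?_)
  exact (div_lt_one (by positivity)).2 (by linarith)

end AnalyticDisk

/-! ### Jack's lemma and holomorphic square roots. -/

/-- **Jack's lemma**: if `ω 0 = 0` and `|ω|` has its maximum over the disk `|z| ≤ |z₀|` at `z₀`, then
`z₀ ω'(z₀) = m ω(z₀)` with `m ≥ 1`. -/
theorem exists_mul_deriv_eq_of_isMaxOn {ω : ℂ → ℂ} (hω : DifferentiableOn ℂ ω unitDisk)
    (h0 : ω 0 = 0) {z₀ : ℂ} (hz₀ : z₀ ∈ unitDisk) (hne : ω z₀ ≠ 0)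
    (hmax : ∀ z : ℂ, ‖z‖ ≤ ‖z₀‖ → ‖ω z‖ ≤ ‖ω z₀‖) :
    ∃ m : ℝ, 1 ≤ m ∧ z₀ * deriv ω z₀ = m * ω z₀ := by
  have hz0 : z₀ ≠ 0 := fun h => hne (h ▸ h0)
  have hder : HasDerivAt ω (deriv ω z₀) z₀ :=
    (hω.differentiableAt (isOpen_ball.mem_nhds hz₀)).hasDerivAt
  set c : ℂ := z₀ * deriv ω z₀ / ω z₀ with hc
  -- Along the circle through z₀, Re(ω/ω(z₀)) peaks at z₀, so its angular derivative Re(ic)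
  -- vanishes.
  have him : c.im = 0 := by
    have h1 : HasDerivAt (fun θ : ℝ => z₀ * Complex.exp (θ * Complex.I)) (z₀ * Complex.I) 0 := by
      have := (((hasDerivAt_id (0 : ℝ)).ofReal_comp).mul_const Complex.I).cexp.const_mul z₀
      simpa using this
    have h2 : HasDerivAt (fun θ : ℝ => ω (z₀ * Complex.exp (θ * Complex.I)) / ω z₀)
        (deriv ω z₀ * (z₀ * Complex.I) / ω z₀) 0 := by
      have h3 : HasDerivAt ω (deriv ω z₀) (z₀ * Complex.exp (((0 : ℝ) : ℂ) * Complex.I)) := by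
        simpa using hder
      exact (h3.comp (0 : ℝ) h1).div_const _
    have h4 := Complex.reCLM.hasFDerivAt.comp_hasDerivAt (0 : ℝ) h2
    have hloc : IsLocalMax (fun θ : ℝ => (ω (z₀ * Complex.exp (θ * Complex.I)) / ω z₀).re) 0 := by
      refine Eventually.of_forall fun θ => ?_
      have hle : ‖ω (z₀ * Complex.exp (θ * Complex.I)) / ω z₀‖ ≤ 1 := by
        rw [norm_div, div_le_one (norm_pos_iff.2 hne)]
        exact hmax _ (by rw [norm_mul, Complex.norm_exp_ofReal_mul_I, mul_one])
      simpa [div_self hne] using (Complex.re_le_norm _).trans hle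
    have h5 := hloc.hasDerivAt_eq_zero h4
    have h6 : deriv ω z₀ * (z₀ * Complex.I) / ω z₀ = c * Complex.I := by rw [hc]; ring
    rw [h6] at h5
    simpa using h5
  -- Schwarz's lemma gives |ω(tz₀)| ≤ t|ω(z₀)|, so the left difference quotients at t = 1 are at
  -- least 1.
  have hre : 1 ≤ c.re := by
    have h1 : HasDerivAt (fun t : ℝ => (t : ℂ) * z₀) z₀ 1 := by
      simpa using ((hasDerivAt_id (1 : ℝ)).ofReal_comp).mul_const z₀
    have h2 : HasDerivAt (fun t : ℝ => ω (t * z₀) / ω z₀) (deriv ω z₀ * z₀ / ω z₀) 1 := by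
      have h3 : HasDerivAt ω (deriv ω z₀) (((1 : ℝ) : ℂ) * z₀) := by simpa using hder
      exact (h3.comp (1 : ℝ) h1).div_const _
    have h4 := Complex.reCLM.hasFDerivAt.comp_hasDerivAt (1 : ℝ) h2
    have h6 : deriv ω z₀ * z₀ / ω z₀ = c := by rw [hc]; ring
    rw [h6] at h4
    have h5 := (hasDerivAt_iff_tendsto_slope.1 h4).mono_left
      (nhdsWithin_mono (1 : ℝ) (show Iio (1 : ℝ) ⊆ {1}ᶜ from fun t ht => (mem_Iio.1 ht).ne))
    refine ge_of_tendsto h5 ?_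
    filter_upwards [Ioo_mem_nhdsLT (zero_lt_one (α := ℝ))] with t ht
    have hball : (t : ℂ) * z₀ ∈ ball (0 : ℂ) ‖z₀‖ := by
      rw [mem_ball_zero_iff, norm_mul, Complex.norm_real, Real.norm_of_nonneg ht.1.le]
      exact mul_lt_of_lt_one_left (norm_pos_iff.2 hz0) ht.2
    have hS := Complex.dist_le_div_mul_dist_of_mapsTo_ball
      (hω.mono (ball_subset_ball (mem_ball_zero_iff.1 hz₀).le)) (R₂ := ‖ω z₀‖)
      (fun z hz => by
        rw [h0, mem_closedBall_zero_iff]; exact hmax z (mem_ball_zero_iff.1 hz).le) hball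
    rw [h0, dist_zero_right, dist_zero_right, norm_mul, Complex.norm_real,
      Real.norm_of_nonneg ht.1.le] at hS
    have hle : ‖ω (t * z₀) / ω z₀‖ ≤ t := by
      rw [norm_div, div_le_iff₀ (norm_pos_iff.2 hne)]
      refine hS.trans_eq ?_
      have := norm_pos_iff.2 hz0
      field_simp
    have hle' := (Complex.re_le_norm _).trans hle
    rw [slope_def_field, Function.comp_apply, Function.comp_apply, Complex.reCLM_apply,
      Complex.reCLM_apply, Complex.ofReal_one, one_mul, div_self hne, Complex.one_re,
      le_div_iff_of_neg (by linarith [ht.2])]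
    linarith
  refine ⟨c.re, hre, ?_⟩
  have : (c.re : ℂ) = c := Complex.ext (by simp) (by simp [him])
  rw [this, hc, div_mul_cancel₀ _ hne]

/-- A holomorphic function without zeros on the disk, equal to `1` at the origin, is the inverse of
a square. -/
theorem exists_eq_inv_sq {g : ℂ → ℂ} (hg : DifferentiableOn ℂ g unitDisk) (h0 : g 0 = 1)
    (hne : ∀ z ∈ unitDisk, g z ≠ 0) :
    ∃ s : ℂ → ℂ, DifferentiableOn ℂ s unitDisk ∧ s 0 = 1 ∧
      ∀ z ∈ unitDisk, s z ≠ 0 ∧ g z = (s z ^ 2)⁻¹ := by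
  have hdiv : DifferentiableOn ℂ (fun z => deriv g z / g z) unitDisk :=
    (hg.deriv isOpen_ball).div hg hne
  -- L is a logarithm of g, and s = exp(-L/2).
  obtain ⟨L, hL0, hL⟩ := hdiv.isExactOn_ball.with_val_at 0 0
  have hLd : DifferentiableOn ℂ L unitDisk := fun z hz =>
    (hL z hz).differentiableAt.differentiableWithinAt
  have hgd : ∀ z ∈ unitDisk, HasDerivAt g (deriv g z) z := fun z hz =>
    (hg.differentiableAt (isOpen_ball.mem_nhds hz)).hasDerivAt
  have hconst : ∀ z ∈ unitDisk, g z * Complex.exp (-L z) = 1 := by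
    intro z hz
    have hd : DifferentiableOn ℂ (fun z => g z * Complex.exp (-L z)) unitDisk :=
      hg.mul hLd.neg.cexp
    have h := isOpen_ball.is_const_of_deriv_eq_zero (convex_ball (0 : ℂ) 1).isPreconnected hd
      (fun w hw => by
        have := ((hgd w hw).mul (hL w hw).neg.cexp).deriv
        have hw0 := hne w hw
        refine this.trans ?_
        simp only [Pi.zero_apply]
        field_simp
        ring) hz (mem_ball_self one_pos)
    simpa [hL0, h0] using h
  refine ⟨fun z => Complex.exp (-L z / 2), (hLd.neg.div_const 2).cexp, by simp [hL0],
    fun z hz => ⟨Complex.exp_ne_zero _, ?_⟩⟩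
  rw [← Complex.exp_nat_mul]
  push_cast
  rw [mul_div_cancel₀ _ two_ne_zero]
  exact eq_inv_of_mul_eq_one_left (hconst z hz)

/-! ### The class U in terms of kernels. -/

namespace AnalyticDisk

/-- If ω = 1 - s reached modulus 1, Jack's lemma at a maximum point would violate the inequality
defining `classU`. -/
theorem norm_one_sub_lt_one_of_mem_classU {f : AnalyticDisk} (hf : f ∈ classU) {s : ℂ → ℂ}
    (hs : DifferentiableOn ℂ s unitDisk) (hs0 : s 0 = 1)
    (hfs : ∀ z ∈ unitDisk, s z ≠ 0 ∧ diskEval f z = z / s z ^ 2) {z : ℂ} (hz : z ∈ unitDisk) :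
    ‖1 - s z‖ < 1 := by
  by_contra! hge
  set ω : ℂ → ℂ := fun z => 1 - s z with hω
  have hωd : DifferentiableOn ℂ ω unitDisk := hs.const_sub 1
  have hsub : closedBall (0 : ℂ) ‖z‖ ⊆ unitDisk :=
    closedBall_subset_ball (mem_ball_zero_iff.1 hz)
  obtain ⟨z₀, hz₀, hmax⟩ := (isCompact_closedBall (0 : ℂ) ‖z‖).exists_isMaxOn
    ⟨0, mem_closedBall_self (norm_nonneg z)⟩ (hωd.continuousOn.mono hsub).norm
  have hz₀D := hsub hz₀
  have hge' : 1 ≤ ‖ω z₀‖ := hge.trans (hmax (by simp : z ∈ closedBall (0 : ℂ) ‖z‖))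
  have hne : ω z₀ ≠ 0 := norm_pos_iff.1 (by linarith)
  have hz0 : z₀ ≠ 0 := fun h => hne (by simp [hω, h, hs0])
  obtain ⟨m, hm, hjack⟩ := exists_mul_deriv_eq_of_isMaxOn hωd (by simp [hω, hs0]) hz₀D hne
    fun w hw => hmax (mem_closedBall_zero_iff.2 (hw.trans (mem_closedBall_zero_iff.1 hz₀)))
  have hsd : HasDerivAt s (deriv s z₀) z₀ :=
    (hs.differentiableAt (isOpen_ball.mem_nhds hz₀D)).hasDerivAt
  have hωs : deriv ω z₀ = -deriv s z₀ := (hsd.const_sub 1).deriv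
  obtain ⟨hs0', hfz⟩ := hfs z₀ hz₀D
  have hfd : deriv (diskEval f) z₀ =
      (s z₀ ^ 2 - z₀ * (2 * s z₀ * deriv s z₀)) / (s z₀ ^ 2) ^ 2 := by
    have hev : diskEval f =ᶠ[𝓝 z₀] fun z => z / s z ^ 2 := by
      filter_upwards [isOpen_ball.mem_nhds hz₀D] with w hw using (hfs w hw).2
    rw [hev.deriv_eq]
    have := ((hasDerivAt_id z₀).div (hsd.pow 2) (pow_ne_zero 2 hs0')).deriv
    refine this.trans ?_
    simp
  have hbound := (hf.2 z₀ hz₀D hz0).2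
  -- Insert s = 1 - ω and z₀s' = -mω into s² - 2zss' - 1. With m ≥ 1 and |ω| ≥ 1 both factors have
  -- modulus at least 1.
  have hkey : deriv (diskEval f) z₀ * (z₀ / diskEval f z₀) ^ 2 - 1 =
      ω z₀ * ((2 * m - 2 : ℝ) - (2 * m - 1 : ℝ) * ω z₀) := by
    have h1 : s z₀ = 1 - ω z₀ := by simp [hω]
    have h2 : z₀ * deriv s z₀ = -(m * ω z₀) := by
      rw [← hjack, hωs]; ring
    have h3 : deriv (diskEval f) z₀ * (z₀ / diskEval f z₀) ^ 2 =
        s z₀ ^ 2 - 2 * s z₀ * (z₀ * deriv s z₀) := by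
      rw [hfd, hfz]
      field_simp
    rw [h3, h2, h1]
    push_cast
    ring
  rw [hkey, norm_mul] at hbound
  have h4 : (2 * m - 1) * ‖ω z₀‖ - (2 * m - 2) ≤
      ‖((2 * m - 2 : ℝ) : ℂ) - (2 * m - 1 : ℝ) * ω z₀‖ := by
    have := norm_sub_norm_le (((2 * m - 1 : ℝ) : ℂ) * ω z₀) ((2 * m - 2 : ℝ) : ℂ)
    rw [norm_sub_rev, norm_mul, Complex.norm_real, Complex.norm_real,
      Real.norm_of_nonneg (by linarith), Real.norm_of_nonneg (by linarith)] at this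
    exact this
  have h5 : 1 ≤ (2 * m - 1) * ‖ω z₀‖ - (2 * m - 2) := by nlinarith
  nlinarith

/-- Every function of the class `U` has the form `z q(z)²` with `q` in the closed convex hull of the
functions `1 / (1 - x z)`. -/
theorem exists_eq_shiftMul_self_of_mem_classU {f : AnalyticDisk} (hf : f ∈ classU) :
    ∃ q ∈ closedConvexHull ℝ (range cauchyKernel), f = shiftMul q q := by
  set g : ℂ → ℂ := dslope (diskEval f) 0 with hg
  have h0 : (0 : ℂ) ∈ unitDisk := mem_ball_self one_pos
  have hgd : DifferentiableOn ℂ g unitDisk :=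
    (Complex.differentiableOn_dslope (isOpen_ball.mem_nhds h0)).2 (differentiableOn_diskEval f)
  have hfg : ∀ z, diskEval f z = z * g z := fun z => by
    have := sub_smul_dslope (diskEval f) 0 z
    simpa [hf.1.1] using this.symm
  have hg0 : g 0 = 1 := by rw [hg, dslope_same, hf.1.2]
  obtain ⟨s, hsd, hs0, hs⟩ := exists_eq_inv_sq hgd hg0 fun z hz => by
    rcases eq_or_ne z 0 with rfl | hz0
    · rw [hg0]; exact one_ne_zero
    · intro h
      exact (hf.2 z hz hz0).1 (by rw [hfg, h, mul_zero])
  have hfs : ∀ z ∈ unitDisk, s z ≠ 0 ∧ diskEval f z = z / s z ^ 2 := fun z hz =>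
    ⟨(hs z hz).1, by rw [hfg, (hs z hz).2, div_eq_mul_inv]⟩
  have hqd : DifferentiableOn ℂ (fun z => (s z)⁻¹) unitDisk := hsd.inv fun z hz => (hs z hz).1
  refine ⟨ofFun _ hqd, mem_closedConvexHull_cauchyKernel ?_ fun z hz => ?_, ?_⟩
  · rw [diskEval_ofFun _ h0, hs0, inv_one]
  · rw [diskEval_ofFun _ hz, Complex.inv_re, le_div_iff₀ (Complex.normSq_pos.2 (hs z hz).1)]
    have h1 := norm_one_sub_lt_one_of_mem_classU hf hsd hs0 hfs hz
    -- |1 - s|² < 1 amounts to |s|² < 2 Re s, that is, Re(1/s) > 1/2.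
    have h2 : Complex.normSq (1 - s z) < 1 := by
      rw [Complex.normSq_eq_norm_sq]
      exact pow_lt_one₀ (norm_nonneg _) h1 two_ne_zero
    rw [Complex.normSq_apply] at h2 ⊢
    simp only [Complex.sub_re, Complex.one_re, Complex.sub_im, Complex.one_im] at h2
    nlinarith
  · refine ext_diskEval fun z hz => ?_
    rw [diskEval_shiftMul _ _ hz, diskEval_ofFun _ hz, (hfs z hz).2]
    have := (hs z hz).1
    field_simp

theorem koebe_mem_classU (x : sphere (0 : ℂ) 1) : koebe x ∈ classU := by
  have hder : ∀ z ∈ unitDisk,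
      deriv (diskEval (koebe x)) z = (1 + x * z) / (1 - x * z) ^ 3 := by
    intro z hz
    have hev : diskEval (koebe x) =ᶠ[𝓝 z] fun z => z / (1 - x * z) ^ 2 := by
      filter_upwards [isOpen_ball.mem_nhds hz] with w hw using diskEval_koebe x hw
    have hne := one_sub_mul_ne_zero x hz
    have h1 : HasDerivAt (fun z : ℂ => 1 - x * z) (-(x : ℂ)) z := by
      simpa using ((hasDerivAt_id z).const_mul (x : ℂ)).const_sub 1
    rw [hev.deriv_eq]
    refine ((hasDerivAt_id z).div (h1.pow 2) (pow_ne_zero 2 hne)).deriv.trans ?_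
    simp only [id_eq, Pi.pow_apply]
    push_cast
    field_simp
    ring
  have h0 : (0 : ℂ) ∈ unitDisk := mem_ball_self one_pos
  refine ⟨⟨by simp [diskEval_koebe x h0], by simp [hder 0 h0]⟩, fun z hz hz0 => ?_⟩
  have hne := one_sub_mul_ne_zero x hz
  rw [diskEval_koebe x hz, hder z hz]
  refine ⟨div_ne_zero hz0 (pow_ne_zero 2 hne), ?_⟩
  have : (1 + (x : ℂ) * z) / (1 - x * z) ^ 3 * (z / (z / (1 - x * z) ^ 2)) ^ 2 - 1 =
      -(x * z) ^ 2 := by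
    field_simp
    ring
  rw [this, norm_neg, norm_pow]
  exact pow_lt_one₀ (norm_nonneg _) (norm_mul_lt_one x hz) two_ne_zero

/-! ### The closed convex hull, its extreme points and the support points. -/

/-- The real part of a continuous linear functional. -/
noncomputable def reFunctional (J : AnalyticDisk →L[ℂ] ℂ) : AnalyticDisk →L[ℝ] ℝ :=
  Complex.reCLM.comp (J.restrictScalars ℝ)

theorem reFunctional_apply (J : AnalyticDisk →L[ℂ] ℂ) (f : AnalyticDisk) :
    reFunctional J f = (J f).re := rfl

theorem re_apply_le_of_mem_closedConvexHull (J : AnalyticDisk →L[ℂ] ℂ) {C : Set AnalyticDisk}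
    {M : ℝ} (hM : ∀ c ∈ C, (J c).re ≤ M) {f : AnalyticDisk} (hf : f ∈ closedConvexHull ℝ C) :
    (J f).re ≤ M :=
  (reFunctional J).le_of_mem_closedConvexHull hM hf

/-- A functional that attains a bound on the closed convex hull of a compact set attains it on the
set. -/
theorem exists_re_apply_eq_of_mem_closedConvexHull (J : AnalyticDisk →L[ℂ] ℂ)
    {C : Set AnalyticDisk} (hC : IsCompact C) (hne : C.Nonempty) {f : AnalyticDisk}
    (hf : f ∈ closedConvexHull ℝ C) (hM : ∀ c ∈ C, (J c).re ≤ (J f).re) :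
    ∃ c ∈ C, (J c).re = (J f).re := by
  obtain ⟨c, hc, hmax⟩ := hC.exists_isMaxOn hne (reFunctional J).continuous.continuousOn
  exact ⟨c, hc, le_antisymm (hM c hc)
    (re_apply_le_of_mem_closedConvexHull J (fun d hd => hmax hd) hf)⟩

theorem range_cauchyKernel_nonempty : (range cauchyKernel).Nonempty :=
  ⟨_, mem_range_self ⟨1, by simp⟩⟩

/-- By linearity in each factor separately, it suffices to test both factors on kernels. -/
theorem re_apply_shiftMul_le (J : AnalyticDisk →L[ℂ] ℂ) {M : ℝ}
    (hM : ∀ x, (J (koebe x)).re ≤ M) {a b : AnalyticDisk}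
    (ha : a ∈ closedConvexHull ℝ (range cauchyKernel))
    (hb : b ∈ closedConvexHull ℝ (range cauchyKernel)) :
    (J (shiftMul b a)).re ≤ M := by
  refine re_apply_le_of_mem_closedConvexHull (J.comp (shiftMul b)) ?_ ha
  rintro _ ⟨x, rfl⟩
  rw [ContinuousLinearMap.comp_apply, shiftMul_comm]
  refine re_apply_le_of_mem_closedConvexHull (J.comp (shiftMul (cauchyKernel x))) ?_ hb
  rintro _ ⟨y, rfl⟩
  rw [ContinuousLinearMap.comp_apply]
  rcases eq_or_ne y x with rfl | hyx
  · rw [shiftMul_cauchyKernel_self]; exact hM y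
  · exact (re_apply_shiftMul_cauchyKernel J hM hyx).1

/-- The closed convex hull of the class `U` is that of the rotated Koebe functions. -/
theorem closedConvexHull_classU :
    closedConvexHull ℝ classU = closedConvexHull ℝ (range koebe) := by
  refine subset_antisymm ?_ ((closedConvexHull ℝ).monotone (range_subset_iff.2 koebe_mem_classU))
  refine closedConvexHull_min (fun f hf => ?_) convex_closedConvexHull isClosed_closedConvexHull
  by_contra hnot
  obtain ⟨J, u, hJ, hu⟩ := RCLike.geometric_hahn_banach_closed_point (𝕜 := ℂ)
    convex_closedConvexHull isClosed_closedConvexHull hnot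
  obtain ⟨q, hq, rfl⟩ := exists_eq_shiftMul_self_of_mem_classU hf
  exact hu.not_ge (re_apply_shiftMul_le J
    (fun x => (hJ _ (subset_closedConvexHull (mem_range_self x))).le) hq hq)

theorem conj_half_mem_unitDisk (x : sphere (0 : ℂ) 1) :
    (starRingEnd ℂ) x / 2 ∈ unitDisk := by
  have hx : ‖(x : ℂ)‖ = 1 := mem_sphere_zero_iff_norm.1 x.2
  rw [mem_ball_zero_iff, norm_div, RCLike.norm_conj, hx]
  norm_num

/-- The functional `f ↦ x f(x̄ / 2)`, whose real part peaks at the Koebe function of `x`. -/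
noncomputable def peakFunctional (x : sphere (0 : ℂ) 1) : AnalyticDisk →L[ℂ] ℂ :=
  (x : ℂ) • evalCLM ⟨(starRingEnd ℂ) x / 2, conj_half_mem_unitDisk x⟩

theorem peakFunctional_koebe (x y : sphere (0 : ℂ) 1) :
    peakFunctional x (koebe y) = 1 / 2 / (1 - y * (starRingEnd ℂ) x / 2) ^ 2 := by
  have hx : (x : ℂ) * (starRingEnd ℂ) x = 1 := by
    rw [Complex.mul_conj, Complex.normSq_eq_norm_sq, mem_sphere_zero_iff_norm.1 x.2]; simp
  change (x : ℂ) • evalCLM _ (koebe y) = _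
  rw [evalCLM_apply, diskEval_koebe y (conj_half_mem_unitDisk x), smul_eq_mul, ← mul_div_assoc,
    ← mul_div_assoc, ← mul_div_assoc, hx]

theorem peakFunctional_koebe_self (x : sphere (0 : ℂ) 1) :
    peakFunctional x (koebe x) = 2 := by
  have hx : (x : ℂ) * (starRingEnd ℂ) x = 1 := by
    rw [Complex.mul_conj, Complex.normSq_eq_norm_sq, mem_sphere_zero_iff_norm.1 x.2]; simp
  rw [peakFunctional_koebe, hx]
  norm_num

theorem re_peakFunctional_koebe_lt {x y : sphere (0 : ℂ) 1} (hxy : y ≠ x) :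
    (peakFunctional x (koebe y)).re < 2 := by
  have hx : (x : ℂ) * (starRingEnd ℂ) x = 1 := by
    rw [Complex.mul_conj, Complex.normSq_eq_norm_sq, mem_sphere_zero_iff_norm.1 x.2]; simp
  set t : ℂ := y * (starRingEnd ℂ) x with ht
  have htn : ‖t‖ = 1 := by
    rw [ht, norm_mul, RCLike.norm_conj, mem_sphere_zero_iff_norm.1 x.2,
      mem_sphere_zero_iff_norm.1 y.2, one_mul]
  have ht1 : t ≠ 1 := fun h => hxy <| Subtype.ext <| by
    calc (y : ℂ) = t * x := by rw [ht, mul_assoc, mul_comm _ (x : ℂ), hx, mul_one]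
      _ = x := by rw [h, one_mul]
  have hsq : t.re * t.re + t.im * t.im = 1 := by
    rw [← Complex.normSq_apply, Complex.normSq_eq_norm_sq, htn, one_pow]
  have hre : t.re < 1 := by
    refine lt_of_le_of_ne ((Complex.re_le_norm t).trans_eq htn) fun h => ht1 ?_
    refine Complex.ext h ?_
    rw [h] at hsq
    have : t.im * t.im = 0 := by linarith
    simpa using this
  -- For |t| = 1 the right side is 5/4 - Re t.
  have hn : 1 / 4 < ‖1 - t / 2‖ ^ 2 := by
    rw [← Complex.normSq_eq_norm_sq, Complex.normSq_apply]
    simp only [Complex.sub_re, Complex.sub_im, Complex.one_re, Complex.one_im,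
      Complex.div_ofNat_re, Complex.div_ofNat_im]
    nlinarith
  rw [peakFunctional_koebe]
  refine (Complex.re_le_norm _).trans_lt ?_
  rw [norm_div, norm_pow, div_lt_iff₀ (by linarith)]
  norm_num
  linarith

/-- The extreme points of the closed convex hull of the rotated Koebe functions. -/
theorem extremePoints_closedConvexHull_koebe :
    (closedConvexHull ℝ (range koebe)).extremePoints ℝ = range koebe := by
  refine subset_antisymm isCompact_range_koebe.extremePoints_closedConvexHull_subset ?_
  rintro _ ⟨x, rfl⟩
  have hle : ∀ f ∈ closedConvexHull ℝ (range koebe), (peakFunctional x f).re ≤ 2 := fun f hf => by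
    refine re_apply_le_of_mem_closedConvexHull _ ?_ hf
    rintro _ ⟨y, rfl⟩
    rcases eq_or_ne y x with rfl | hyx
    · rw [peakFunctional_koebe_self]; norm_num
    · exact (re_peakFunctional_koebe_lt hyx).le
  have hmem : koebe x ∈ closedConvexHull ℝ (range koebe) :=
    subset_closedConvexHull (mem_range_self x)
  refine exposedPoints_subset_extremePoints ⟨hmem, reFunctional (peakFunctional x), ?_⟩
  intro f hf
  have hx : (peakFunctional x (koebe x)).re = 2 := by rw [peakFunctional_koebe_self]; norm_num
  refine ⟨by rw [reFunctional_apply, reFunctional_apply, hx]; exact hle f hf, fun h => ?_⟩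
  rw [reFunctional_apply, reFunctional_apply, hx] at h
  have h2 : (peakFunctional x f).re = 2 := le_antisymm (hle f hf) h
  refine isCompact_range_koebe.eq_of_mem_closedConvexHull_of_unique_max
    (reFunctional (peakFunctional x)) ?_ ?_ hf
  · intro g hg
    rw [reFunctional_apply, reFunctional_apply, h2]
    exact hle g (subset_closedConvexHull hg)
  · rintro _ ⟨y, rfl⟩ hy
    rw [reFunctional_apply, reFunctional_apply, h2] at hy
    by_contra hne
    exact (re_peakFunctional_koebe_lt fun hyx => hne (by rw [hyx])).ne hy

theorem koebe_mem_supportPoints (x : sphere (0 : ℂ) 1) : koebe x ∈ supportPoints classU := by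
  have hx : (peakFunctional x (koebe x)).re = 2 := by rw [peakFunctional_koebe_self]; norm_num
  have hy : -x ≠ x := by
    intro h
    have h1 : -(x : ℂ) = x := congrArg Subtype.val h
    have h2 : (x : ℂ) = 0 := self_eq_neg.1 h1.symm
    simpa [h2] using mem_sphere_zero_iff_norm.1 x.2
  refine ⟨koebe_mem_classU x, peakFunctional x, ⟨koebe x, koebe_mem_classU x, koebe (-x),
    koebe_mem_classU _, ?_⟩, fun f hf => ?_⟩
  · rw [hx]; exact (re_peakFunctional_koebe_lt hy).ne'
  · rw [hx]
    have hf' : f ∈ closedConvexHull ℝ (range koebe) :=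
      closedConvexHull_classU ▸ subset_closedConvexHull hf
    refine re_apply_le_of_mem_closedConvexHull _ ?_ hf'
    rintro _ ⟨y, rfl⟩
    rcases eq_or_ne y x with rfl | hyx
    · exact hx.le
    · exact (re_peakFunctional_koebe_lt hyx).le

/-- If `Re J` is at most `Re J (z q²)` on the Koebe functions but not constantly equal to it, then
`z q²` is a Koebe function. -/
theorem shiftMul_self_mem_range_koebe (J : AnalyticDisk →L[ℂ] ℂ) {q : AnalyticDisk}
    (hq : q ∈ closedConvexHull ℝ (range cauchyKernel))
    (hM : ∀ x, (J (koebe x)).re ≤ (J (shiftMul q q)).re)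
    (hne : ∃ x, (J (koebe x)).re ≠ (J (shiftMul q q)).re) :
    shiftMul q q ∈ range koebe := by
  -- With one factor fixed as q, the maximum is also attained at some kernel x in the other. Fixing
  -- that kernel instead, strictness for y ≠ x makes it the only maximizer, so q equals it.
  obtain ⟨_, ⟨x, rfl⟩, hx⟩ := exists_re_apply_eq_of_mem_closedConvexHull (J.comp (shiftMul q))
    isCompact_range_cauchyKernel range_cauchyKernel_nonempty hq (by
      rintro _ ⟨x, rfl⟩
      exact re_apply_shiftMul_le J hM (subset_closedConvexHull (mem_range_self x)) hq)
  rw [ContinuousLinearMap.comp_apply, ContinuousLinearMap.comp_apply, shiftMul_comm] at hx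
  have hqx : q = cauchyKernel x := by
    refine isCompact_range_cauchyKernel.eq_of_mem_closedConvexHull_of_unique_max
      (reFunctional (J.comp (shiftMul (cauchyKernel x)))) ?_ ?_ hq
    · rintro _ ⟨y, rfl⟩
      rw [reFunctional_apply, reFunctional_apply, ContinuousLinearMap.comp_apply,
        ContinuousLinearMap.comp_apply, hx]
      exact re_apply_shiftMul_le J hM (subset_closedConvexHull (mem_range_self y))
        (subset_closedConvexHull (mem_range_self x))
    · rintro _ ⟨y, rfl⟩ hy
      rw [reFunctional_apply, reFunctional_apply, ContinuousLinearMap.comp_apply,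
        ContinuousLinearMap.comp_apply, hx] at hy
      by_contra h
      exact ((re_apply_shiftMul_cauchyKernel J hM fun hyx => h (by rw [hyx])).2 hne).ne hy
  exact ⟨x, by rw [hqx, shiftMul_cauchyKernel_self]⟩

theorem supportPoints_classU : supportPoints classU = range koebe := by
  refine subset_antisymm ?_ (range_subset_iff.2 koebe_mem_supportPoints)
  rintro f ⟨hf, J, ⟨g, hg, h, hh, hgh⟩, hmax⟩
  obtain ⟨q, hq, hfq⟩ := exists_eq_shiftMul_self_of_mem_classU hf
  have hM : ∀ x, (J (koebe x)).re ≤ (J f).re := fun x => hmax _ (koebe_mem_classU x)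
  have hne : ∃ x, (J (koebe x)).re ≠ (J f).re := by
    by_contra! hall
    -- Applying the hull bound to -J as well, constancy on the Koebe functions would spread to all
    -- of `classU`.
    have hconst : ∀ k ∈ classU, (J k).re = (J f).re := fun k hk => by
      have hk' : k ∈ closedConvexHull ℝ (range koebe) :=
        closedConvexHull_classU ▸ subset_closedConvexHull hk
      refine le_antisymm (hmax k hk) ?_
      have := re_apply_le_of_mem_closedConvexHull ((-1 : ℂ) • J) (M := -(J f).re) (by
        rintro _ ⟨x, rfl⟩
        simp [hall x]) hk'
      simpa using this
    exact hgh ((hconst g hg).trans (hconst h hh).symm)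
  subst hfq
  exact shiftMul_self_mem_range_koebe J hq hM hne

end AnalyticDisk

theorem theorem2p1 :
    supportPoints classU = Set.extremePoints ℝ (closedConvexHull ℝ classU) ∧
      Set.extremePoints ℝ (closedConvexHull ℝ classU) = koebeFunctions := by
  rw [AnalyticDisk.closedConvexHull_classU, AnalyticDisk.extremePoints_closedConvexHull_koebe,
    AnalyticDisk.supportPoints_classU, AnalyticDisk.koebeFunctions_eq_range]
  exact ⟨rfl, rfl⟩
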